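/- **Proposition (Exponential isomorphism).** Let $\mathbb K$ be a field of characteristic zero. *Setting.* Let $\mathrm{NCP}$ be the set of standard noncrossing partitions of the sets $[n]$, $n\ge 1$; restrictions $P_{|X}$ to subsets $X\subseteq[n]$ are standardized along the monotone bijection $X\cong\{1,\dots,\sharp X\}$. Let $\mathcal H$ be the free associative $\mathbb K$-algebra on $\mathrm{NCP}$ (the empty partition being identified with $1$), with the counit $\varepsilon$ that vanishes on $\mathrm{NCP}$, $\mathcal H_+=\ker\varepsilon$, and with the multiplicative coproduct given for $P\in\mathrm{NCP}$ by $$\Delta(P)=\sum_{(L,U)\in\mathrm{cut}(P)} P_{|L}\otimes P_{|U_0}\cdots P_{|U_k},$$ where $(L,U)$ runs over the splittings of the set of blocks of $P$ such that $L$ contains, with any block $\sigma$, every block $\pi$ whose convex hull meets $\sigma$, and where $U_0,\dots,U_k$ are the (possibly empty) gaps below, between and above the $k$ elements of the underlying set of $L$. Let $\mathcal B$ be the free commutative $\mathbb K$-algebra on $\mathrm{NCP}$, and let $\rho:\mathcal H\to\mathcal H\otimes\mathcal B$ be the algebra map with $$\rho(P)=\sum_{Q\ge P} Q\otimes P/Q,\qquad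 P/Q=\prod_{\tau\in Q}P_{|\tau},$$ the sum being over the noncrossing partitions $Q$ coarser than or equal to $P$. For linear forms $\alpha,\beta$ on $\mathcal H$ put $\alpha\star\beta=(\alpha\otimes\beta)\circ\Delta$ (with unit $\varepsilon$), and for a character (unital algebra map) $\gamma:\mathcal B\to\mathbb K$ put $\alpha\curvearrowleft\gamma=(\alpha\otimes\gamma)\circ\rho$. Let $G$ be the group of characters of $\mathcal H$ under $\star$, and $\mathfrak g$ the Lie algebra of infinitesimal characters, i.e. of linear forms that vanish at $1$ and on $(\mathcal H_+)^2$, with bracket $[\alpha,\beta]=\alpha\star\beta-\beta\star\alpha$. For $\kappa\in\mathfrak g$ let $\exp_\star(\kappa)=\sum_{n\ge0}\kappa^{\star n}/n!$ (a finite sum at each element of $\mathcal H$). Let $e\in\mathfrak g$ be the infinitesimal character with $e(P)=1$ if $P\in\mathrm{NCP}$ has exactly one block and $e(P)=0$ for the other $P\in\mathrm{NCP}$, and put $\psi_\star=\exp_\star(e)$. *Statement.* For $\kappa\in\mathfrak g$ let $K:\mathcal B\to\mathbb K$ be the character with $K(P)=\kappa(P)$ for all $P\in\mathrm{NCP}$.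 Then $\exp_\star(\kappa)\in G$ and $$\exp_\star(\kappa)=\psi_\star\curvearrowleft K;$$ that is, for $\phi\in G$ we have $\phi=\exp_\star(\kappa)$ if and only if $\phi=\psi_\star\curvearrowleft K$. Moreover, for every character $\gamma$ of $\mathcal B$, the linear map $\alpha\mapsto\alpha\curvearrowleft\gamma$ restricts to a group endomorphism of $G$ and to a Lie algebra endomorphism of $\mathfrak g$. -/

import Mathlib

open scoped TensorProduct

noncomputable section

namespace NCPart

/-! ### Noncrossing partitions -/

/-- A partition of `[n]` (given by the equivalence relation "being in the same block") is
noncrossing if there are no `a < c < b < d` with `a, b` in one block and `c, d` in another. -/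
def IsNoncrossing {n : ℕ} (r : Setoid (Fin n)) : Prop :=
  ∀ a c b d : Fin n, a < c → c < b → b < d → r a b → r c d → r a c

/-- Standard noncrossing partitions, the empty partition being included. -/
structure NCP₀ where
  /-- the number of elements that are partitioned -/
  deg : ℕ
  /-- the relation "being in the same block" -/
  rel : Setoid (Fin deg)
  noncrossing : IsNoncrossing rel

/-- Standard noncrossing partitions of non-empty sets. -/
abbrev NCP : Type := {P : NCP₀ // 0 < P.deg}

/-- The number of blocks. -/
def NCP₀.numBlocks (P : NCP₀) : ℕ := Nat.card (Quotient P.rel)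

/-- The restriction of `P` to a subset `X` of its underlying set, standardized along the
monotone bijection of `X` with `{1, …, #X}`. -/
def NCP₀.restrict (P : NCP₀) (X : Finset (Fin P.deg)) : NCP₀ where
  deg := X.card
  rel := P.rel.comap (X.orderEmbOfFin rfl)
  noncrossing := fun _ _ _ _ hac hcb hbd hab hcd =>
    P.noncrossing _ _ _ _ ((X.orderEmbOfFin rfl).strictMono hac)
      ((X.orderEmbOfFin rfl).strictMono hcb) ((X.orderEmbOfFin rfl).strictMono hbd) hab hcd

/-- `P.IsLowerset L`: the set `L` is a union of blocks of `P`, and these blocks form a lowerset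
for the relation `π → σ :↔ Conv(π) ∩ σ ≠ ∅` between blocks; that is, if `L` contains the block
of `b`, and `b` lies in the convex hull of a block (`a ≤ b ≤ c` with `a, c` in that block), then
`L` contains the latter block. Cuts `(L, U)` of `P` correspond to lowersets, with `U = Lᶜ`. -/
def NCP₀.IsLowerset (P : NCP₀) (L : Finset (Fin P.deg)) : Prop :=
  (∀ a b, P.rel a b → a ∈ L → b ∈ L) ∧
    ∀ a b c, P.rel a c → a ≤ b → b ≤ c → b ∈ L → a ∈ L

/-- If `x₁ < ⋯ < x_k` are the elements of `L`, then `gap L i` is the set of all elements strictly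
between `x_i` and `x_{i+1}` (below `x₁` for `i = 0`, above `x_k` for `i = k`): the elements
outside `L` that have exactly `i` elements of `L` below them. -/
def gap {n : ℕ} (L : Finset (Fin n)) (i : ℕ) : Finset (Fin n) :=
  {y | y ∉ L ∧ (L.filter (· < y)).card = i}

instance instFiniteSetoidFin (n : ℕ) : Finite (Setoid (Fin n)) :=
  Finite.of_injective (fun r : Setoid (Fin n) => (r : Fin n → Fin n → Prop))
    fun _ _ h => Setoid.ext fun a b => iff_of_eq (congrFun (congrFun h a) b)

/-- The set of all noncrossing partitions `Q ≥ P` (coarser than or equal to `P`) of the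
underlying set of `P`. -/
def NCP₀.coarsenings (P : NCP₀) : Finset (Setoid (Fin P.deg)) :=
  (Set.toFinite {Q : Setoid (Fin P.deg) | P.rel ≤ Q ∧ IsNoncrossing Q}).toFinset

theorem NCP₀.mem_coarsenings (P : NCP₀) (Q : Setoid (Fin P.deg)) :
    Q ∈ P.coarsenings ↔ P.rel ≤ Q ∧ IsNoncrossing Q := by
  simp [NCP₀.coarsenings]

/-- A coarsening of `P` as a partition. -/
def NCP₀.coarsen (P : NCP₀) (Q : P.coarsenings) : NCP₀ :=
  ⟨P.deg, Q.1, ((P.mem_coarsenings Q.1).1 Q.2).2⟩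

/-! ### The gap-insertion Hopf algebra `H` and the block-substitution bialgebra `B` -/

section Algebras

variable (𝕜 : Type*) [Field 𝕜]

/-- The underlying algebra of the gap-insertion Hopf algebra: the free associative algebra on
the non-empty noncrossing partitions. -/
abbrev H : Type _ := FreeAlgebra 𝕜 NCP

/-- The underlying algebra of the block-substitution bialgebra: the free commutative algebra on
the non-empty noncrossing partitions. -/
abbrev B : Type _ := MvPolynomial NCP 𝕜

/-- The class of a noncrossing partition in `H`; the empty partition is identified with `1`. -/
def genH (P : NCP₀) : H 𝕜 :=
  open Classical in if h : 0 < P.deg then FreeAlgebra.ι 𝕜 (⟨P, h⟩ : NCP) else 1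

/-- The class of a noncrossing partition in `B` (used below for non-empty partitions only). -/
def genB (P : NCP₀) : B 𝕜 :=
  open Classical in if h : 0 < P.deg then MvPolynomial.X (⟨P, h⟩ : NCP) else 1

/-- The reduced gap monomial of the upperset `Lᶜ`. -/
def gapMonomial (P : NCP₀) (L : Finset (Fin P.deg)) : H 𝕜 :=
  ((List.range (L.card + 1)).map fun i => genH 𝕜 (P.restrict (gap L i))).prod

/-- The value `∑_{(L,U) ∈ cut(P)} L ⊗ U` of the coproduct of `H` at a partition. -/
def cutSum (P : NCP₀) : H 𝕜 ⊗[𝕜] H 𝕜 :=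
  open Classical in
    ∑ L ∈ Finset.univ.filter P.IsLowerset, genH 𝕜 (P.restrict L) ⊗ₜ[𝕜] gapMonomial 𝕜 P L

/-- The coproduct `Δ` of `H`. -/
def Δ : H 𝕜 →ₐ[𝕜] H 𝕜 ⊗[𝕜] H 𝕜 :=
  FreeAlgebra.lift 𝕜 fun P : NCP => cutSum 𝕜 P.1

/-- The counit of `H`. -/
def counitH : H 𝕜 →ₐ[𝕜] 𝕜 :=
  FreeAlgebra.lift 𝕜 fun _ : NCP => (0 : 𝕜)

/-- The monomial `P / Q = ∏_τ P|τ`, where `τ` runs over the blocks of `Q`. -/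
def fibre (P : NCP₀) (Q : Setoid (Fin P.deg)) : B 𝕜 :=
  open Classical in
    ∏ τ : Quotient Q, genB 𝕜 (P.restrict {x | (Quotient.mk Q x) = τ})

/-- The coaction `ρ : H → H ⊗ B`, the algebra map with `ρ(P) = ∑_{P ≤ Q} Q ⊗ P/Q`. -/
def ρ : H 𝕜 →ₐ[𝕜] H 𝕜 ⊗[𝕜] B 𝕜 :=
  FreeAlgebra.lift 𝕜 fun P : NCP =>
    ∑ Q : P.1.coarsenings, genH 𝕜 (P.1.coarsen Q) ⊗ₜ[𝕜] fibre 𝕜 P.1 Q.1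

variable {𝕜}

/-- The convolution product `α ⋆ β = (α ⊗ β) ∘ Δ` of linear forms on `H`. -/
def conv (α β : Module.Dual 𝕜 (H 𝕜)) : Module.Dual 𝕜 (H 𝕜) :=
  LinearMap.mul' 𝕜 𝕜 ∘ₗ TensorProduct.map α β ∘ₗ (Δ 𝕜).toLinearMap

/-- Convolution powers; the unit of the convolution product is the counit. -/
def convPow (α : Module.Dual 𝕜 (H 𝕜)) : ℕ → Module.Dual 𝕜 (H 𝕜)
  | 0 => (counitH 𝕜).toLinearMap
  | n + 1 => conv α (convPow α n)

/-- The right action `α ↶ γ = (α ⊗ γ) ∘ ρ` of characters of `B` on linear forms on `H`. -/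
def act (α : Module.Dual 𝕜 (H 𝕜)) (γ : B 𝕜 →ₐ[𝕜] 𝕜) : Module.Dual 𝕜 (H 𝕜) :=
  LinearMap.mul' 𝕜 𝕜 ∘ₗ TensorProduct.map α γ.toLinearMap ∘ₗ (ρ 𝕜).toLinearMap

variable (𝕜)

/-- The set `G` of characters of `H`, as linear forms. -/
def characters : Set (Module.Dual 𝕜 (H 𝕜)) :=
  {φ | φ 1 = 1 ∧ ∀ x y, φ (x * y) = φ x * φ y}

/-- The space `𝔤` of infinitesimal characters of `H`: the linear forms that vanish at `1` and on
`(H₊)²`, where `H₊` is the kernel of the counit. -/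
def infChar : Submodule 𝕜 (Module.Dual 𝕜 (H 𝕜)) where
  carrier := {κ | κ 1 = 0 ∧ ∀ x y, counitH 𝕜 x = 0 → counitH 𝕜 y = 0 → κ (x * y) = 0}
  zero_mem' := by simp
  add_mem' := by
    rintro a b ⟨ha, ha'⟩ ⟨hb, hb'⟩
    exact ⟨by simp [ha, hb], fun x y hx hy => by simp [ha' x y hx hy, hb' x y hx hy]⟩
  smul_mem' := by
    rintro c a ⟨ha, ha'⟩
    exact ⟨by simp [ha], fun x y hx hy => by simp [ha' x y hx hy]⟩

variable {𝕜}

/-- The Lie bracket `[α, β] = α ⋆ β - β ⋆ α`. -/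
def bracket (α β : Module.Dual 𝕜 (H 𝕜)) : Module.Dual 𝕜 (H 𝕜) :=
  conv α β - conv β α

/-- The bijection `Θ : 𝔤 → G`: the character that agrees with `κ` on partitions. -/
def Theta (κ : infChar 𝕜) : H 𝕜 →ₐ[𝕜] 𝕜 :=
  FreeAlgebra.lift 𝕜 fun P : NCP => κ.1 (FreeAlgebra.ι 𝕜 P)

/-- The character of `B` (the abelianization of `H`) that corresponds to a character of `H`. -/
def bar (φ : H 𝕜 →ₐ[𝕜] 𝕜) : B 𝕜 →ₐ[𝕜] 𝕜 :=
  MvPolynomial.aeval fun P : NCP => φ (FreeAlgebra.ι 𝕜 P)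

/-- The infinitesimal character with given values on partitions. -/
def infCharOf (f : NCP → 𝕜) : infChar 𝕜 :=
  ⟨TrivSqZeroExt.sndHom 𝕜 𝕜 ∘ₗ
      (FreeAlgebra.lift 𝕜 fun P : NCP => (TrivSqZeroExt.inr (f P) :
        TrivSqZeroExt 𝕜 𝕜)).toLinearMap, by
    have key : ∀ x, TrivSqZeroExt.fst ((FreeAlgebra.lift 𝕜 fun P : NCP =>
        (TrivSqZeroExt.inr (f P) : TrivSqZeroExt 𝕜 𝕜)) x) = counitH 𝕜 x := by
      intro x
      have h : (TrivSqZeroExt.fstHom 𝕜 𝕜 𝕜).comp (FreeAlgebra.lift 𝕜 fun P : NCP =>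
          (TrivSqZeroExt.inr (f P) : TrivSqZeroExt 𝕜 𝕜)) = counitH 𝕜 := by
        apply FreeAlgebra.hom_ext
        funext P
        simp [counitH]
      exact DFunLike.congr_fun h x
    refine ⟨by simp, fun x y hx hy => ?_⟩
    simp only [LinearMap.comp_apply, AlgHom.toLinearMap_apply, map_mul,
      TrivSqZeroExt.sndHom_apply, TrivSqZeroExt.snd_mul, key, hx, hy]
    simp⟩

theorem infCharOf_ι (f : NCP → 𝕜) (P : NCP) :
    (infCharOf f).1 (FreeAlgebra.ι 𝕜 P) = f P := by
  simp [infCharOf]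

variable (𝕜)

/-- The infinitesimal character `e` with `e(P) = 1` if the partition `P` has exactly one block
and `e(P) = 0` otherwise. -/
def e : infChar 𝕜 :=
  infCharOf fun P : NCP => if P.1.numBlocks = 1 then 1 else 0

/-! ### Local finiteness of the exponential series -/

/-- The span of the monomials of total degree `d`. -/
def homog (d : ℕ) : Submodule 𝕜 (H 𝕜) :=
  Submodule.span 𝕜 {x | ∃ l : List NCP, (l.map fun P => P.1.deg).sum = d ∧
    x = (l.map (FreeAlgebra.ι 𝕜)).prod}

/-- The homogeneous component of degree `d` of `H ⊗ H`. -/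
def homogT (d : ℕ) : Submodule 𝕜 (H 𝕜 ⊗[𝕜] H 𝕜) :=
  Submodule.span 𝕜 {x | ∃ i j, i + j = d ∧ ∃ a ∈ homog 𝕜 i, ∃ b ∈ homog 𝕜 j, x = a ⊗ₜ[𝕜] b}

variable {𝕜}

theorem one_mem_homog : (1 : H 𝕜) ∈ homog 𝕜 0 :=
  Submodule.subset_span ⟨[], by simp, by simp⟩

theorem mul_mem_homog {i j : ℕ} {x y : H 𝕜} (hx : x ∈ homog 𝕜 i) (hy : y ∈ homog 𝕜 j) :
    x * y ∈ homog 𝕜 (i + j) := by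
  have h : homog 𝕜 i * homog 𝕜 j ≤ homog 𝕜 (i + j) := by
    rw [homog, homog, Submodule.span_mul_span, Submodule.span_le]
    rintro _ ⟨_, ⟨l, hl, rfl⟩, _, ⟨m, hm, rfl⟩, rfl⟩
    exact Submodule.subset_span ⟨l ++ m, by rw [List.map_append, List.sum_append, hl, hm], by simp⟩
  exact h (Submodule.mul_mem_mul hx hy)

theorem genH_mem_homog (P : NCP₀) : genH 𝕜 P ∈ homog 𝕜 P.deg := by
  by_cases h : 0 < P.deg
  · rw [genH, dif_pos h]
    exact Submodule.subset_span ⟨[⟨P, h⟩], by simp, by simp⟩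
  · rw [genH, dif_neg h, Nat.eq_zero_of_not_pos h]
    exact one_mem_homog

theorem listProd_mem_homog {ι : Type*} (l : List ι) (f : ι → H 𝕜) (d : ι → ℕ)
    (h : ∀ i ∈ l, f i ∈ homog 𝕜 (d i)) : (l.map f).prod ∈ homog 𝕜 (l.map d).sum := by
  induction l with
  | nil => simpa using one_mem_homog
  | cons i l ih =>
    simp only [List.map_cons, List.prod_cons, List.sum_cons]
    exact mul_mem_homog (h i (by simp)) (ih fun j hj => h j (by simp [hj]))

theorem card_add_sum_card_gap {n : ℕ} (L : Finset (Fin n)) :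
    L.card + ((List.range (L.card + 1)).map fun i => (gap L i).card).sum = n := by
  have h1 : ((List.range (L.card + 1)).map fun i => (gap L i).card).sum
      = ∑ i ∈ Finset.range (L.card + 1), (gap L i).card := rfl
  have h2 : Lᶜ.card = ∑ i ∈ Finset.range (L.card + 1),
      (Lᶜ.filter fun y => (L.filter (· < y)).card = i).card :=
    Finset.card_eq_sum_card_fiberwise fun y _ => by
      simpa using Nat.lt_succ_of_le (Finset.card_filter_le L (· < y))
  have h3 : ∀ i, gap L i = Lᶜ.filter fun y => (L.filter (· < y)).card = i := by
    intro i
    ext y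
    simp [gap]
  rw [h1]
  simp only [h3]
  rw [← h2, Finset.card_add_card_compl, Fintype.card_fin]

theorem mul_mem_homogT {i j : ℕ} {x y : H 𝕜 ⊗[𝕜] H 𝕜} (hx : x ∈ homogT 𝕜 i)
    (hy : y ∈ homogT 𝕜 j) : x * y ∈ homogT 𝕜 (i + j) := by
  have h : homogT 𝕜 i * homogT 𝕜 j ≤ homogT 𝕜 (i + j) := by
    rw [homogT, homogT, Submodule.span_mul_span, Submodule.span_le]
    rintro _ ⟨_, ⟨i₁, i₂, hi, a, ha, b, hb, rfl⟩, _, ⟨j₁, j₂, hj, c, hc, d, hd, rfl⟩, rfl⟩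
    refine Submodule.subset_span ⟨i₁ + j₁, i₂ + j₂, by omega, a * c, mul_mem_homog ha hc,
      b * d, mul_mem_homog hb hd, ?_⟩
    simp
  exact h (Submodule.mul_mem_mul hx hy)

theorem cutSum_mem_homogT (P : NCP₀) : cutSum 𝕜 P ∈ homogT 𝕜 P.deg := by
  refine Submodule.sum_mem _ fun L _ => Submodule.subset_span
    ⟨_, _, card_add_sum_card_gap L, _, genH_mem_homog (P.restrict L), _, ?_, rfl⟩
  exact listProd_mem_homog _ _ _ fun i _ => genH_mem_homog (P.restrict (gap L i))

theorem Δ_mem_homogT {d : ℕ} {x : H 𝕜} (hx : x ∈ homog 𝕜 d) : Δ 𝕜 x ∈ homogT 𝕜 d := by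
  have h : homog 𝕜 d ≤ (homogT 𝕜 d).comap (Δ 𝕜).toLinearMap := by
    rw [homog, Submodule.span_le]
    rintro _ ⟨l, rfl, rfl⟩
    clear hx
    induction l with
    | nil =>
      refine Submodule.subset_span ⟨0, 0, rfl, 1, one_mem_homog, 1, one_mem_homog, ?_⟩
      simp [Algebra.TensorProduct.one_def]
    | cons P l ih =>
      simp only [List.map_cons, List.prod_cons, List.sum_cons, Submodule.comap_coe,
        Set.mem_preimage, AlgHom.toLinearMap_apply, map_mul, SetLike.mem_coe] at ih ⊢
      refine mul_mem_homogT ?_ ih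
      simpa [Δ] using cutSum_mem_homogT (𝕜 := 𝕜) P.1
  exact h hx

theorem infChar_homog_zero (κ : infChar 𝕜) {x : H 𝕜} (hx : x ∈ homog 𝕜 0) : κ.1 x = 0 := by
  have h : homog 𝕜 0 ≤ LinearMap.ker κ.1 := by
    rw [homog, Submodule.span_le]
    rintro _ ⟨l, hl, rfl⟩
    cases l with
    | nil => simpa using κ.2.1
    | cons P l =>
      have := P.2
      simp only [List.map_cons, List.sum_cons] at hl
      omega
  exact h hx

/-- The `n`-th convolution power of an infinitesimal character vanishes in degrees `< n`. -/
theorem convPow_eq_zero (κ : infChar 𝕜) (n : ℕ) :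
    ∀ d < n, ∀ x ∈ homog 𝕜 d, convPow κ.1 n x = 0 := by
  induction n with
  | zero => intro d hd; omega
  | succ n ih =>
    intro d hd x hx
    have h : homogT 𝕜 d ≤
        LinearMap.ker (LinearMap.mul' 𝕜 𝕜 ∘ₗ TensorProduct.map κ.1 (convPow κ.1 n)) := by
      rw [homogT, Submodule.span_le]
      rintro _ ⟨i, j, hij, a, ha, b, hb, rfl⟩
      rcases Nat.eq_zero_or_pos i with rfl | hi
      · simp [infChar_homog_zero κ ha]
      · simp [ih j (by omega) b hb]
    exact h (Δ_mem_homogT hx)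

theorem iSup_homog : ⨆ d, homog 𝕜 d = ⊤ := by
  have h : ∀ x : H 𝕜, x ∈ ⨆ d, homog 𝕜 d := by
    intro x
    induction x using FreeAlgebra.induction with
    | grade0 r =>
      rw [Algebra.algebraMap_eq_smul_one]
      exact Submodule.smul_mem _ _ (Submodule.mem_iSup_of_mem 0 one_mem_homog)
    | grade1 P =>
      exact Submodule.mem_iSup_of_mem P.1.deg
        (Submodule.subset_span ⟨[P], by simp, by simp⟩)
    | mul a b ha hb =>
      have : (⨆ d, homog 𝕜 d) * (⨆ d, homog 𝕜 d) ≤ ⨆ d, homog 𝕜 d := by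
        simp only [Submodule.iSup_mul, Submodule.mul_iSup, iSup_le_iff]
        intro i j
        rw [Submodule.mul_le]
        exact fun x hx y hy => Submodule.mem_iSup_of_mem _ (mul_mem_homog hx hy)
      exact this (Submodule.mul_mem_mul ha hb)
    | add a b ha hb => exact Submodule.add_mem _ ha hb
  exact eq_top_iff.2 fun x _ => h x

/-- At each element of `H`, all but finitely many convolution powers of an infinitesimal
character vanish. -/
theorem exists_convPow_eq_zero (κ : infChar 𝕜) (x : H 𝕜) :
    ∃ N, ∀ n, N ≤ n → convPow κ.1 n x = 0 := by
  have hx : x ∈ ⨆ d, homog 𝕜 d := by rw [iSup_homog]; trivial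
  induction hx using Submodule.iSup_induction' with
  | mem d x hx => exact ⟨d + 1, fun n hn => convPow_eq_zero κ n d (by omega) x hx⟩
  | zero => exact ⟨0, by simp⟩
  | add x y _ _ hx hy =>
    obtain ⟨N, hN⟩ := hx
    obtain ⟨M, hM⟩ := hy
    exact ⟨max N M, fun n hn => by
      rw [map_add, hN n (by omega), hM n (by omega), add_zero]⟩

theorem expSeries_finite (κ : infChar 𝕜) (x : H 𝕜) :
    (Function.support fun n : ℕ => (n.factorial : 𝕜)⁻¹ * convPow κ.1 n x).Finite := by
  obtain ⟨N, hN⟩ := exists_convPow_eq_zero κ x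
  refine (Set.finite_Iio N).subset fun n hn => ?_
  by_contra h
  exact hn (by simp [hN n (by simpa using h)])

/-- The exponential `exp_⋆(κ) = ∑_n κ^{⋆n} / n!` of an infinitesimal character; the sum is
finite at each element of `H`. -/
def expStar (κ : infChar 𝕜) : Module.Dual 𝕜 (H 𝕜) where
  toFun x := ∑ᶠ n : ℕ, (n.factorial : 𝕜)⁻¹ * convPow κ.1 n x
  map_add' x y := by
    rw [← finsum_add_distrib (expSeries_finite κ x) (expSeries_finite κ y)]
    simp only [map_add, mul_add]
  map_smul' c x := by
    simp only [map_smul, smul_eq_mul, RingHom.id_apply]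
    rw [mul_finsum (fun n : ℕ => (n.factorial : 𝕜)⁻¹ * convPow κ.1 n x) c]
    exact finsum_congr fun n => by ring

variable (𝕜)

/-- The universal linear form `ψ_⋆ = exp_⋆(e)`. -/
def psiStar : Module.Dual 𝕜 (H 𝕜) := expStar (e 𝕜)

end Algebras

end NCPart

end

/-! The action of γ is precomposition with the algebra endomorphism `actEnd γ`, that is (id ⊗ γ) ∘
ρ, of H (`act_apply`). Being multiplicative and counit-preserving, it maps G to G and 𝔤 to 𝔤. Once
it is known to commute with Δ, precomposition respects ⋆, the convolution powers and hence exp_⋆.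
Since e ↶ K = κ (`act_e`), it follows that exp_⋆(κ) = exp_⋆(e ↶ K) = exp_⋆(e) ↶ K.

The combinatorial core is `Δ_comp_actEnd`. At P, its left side is a sum over pairs of a coarsening Q
≥ P and a lowerset L of Q. Such an L is also a lowerset of P. For fixed L, choosing Q amounts to
choosing coarsenings of P on L and on each gap independently: these pieces do not cross each other,
so the glued partition is noncrossing. The monomial P/Q factors over the pieces, which gives the
right side.

That exp_⋆(κ) is a character rests on the binomial rule `divPow_mul` for κ^{⋆n}/n!; this needs the
left counit law but no coassociativity. -/

noncomputable section

namespace NCPart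

/-! ### The action as precomposition, and its effect on convolution. -/

section Algebraic

variable {𝕜 : Type*} [Field 𝕜]

/-- The linear form `α ⊗ β` on `H ⊗ H`. -/
def tensorForm (α β : Module.Dual 𝕜 (H 𝕜)) : H 𝕜 ⊗[𝕜] H 𝕜 →ₗ[𝕜] 𝕜 :=
  LinearMap.mul' 𝕜 𝕜 ∘ₗ TensorProduct.map α β

@[simp]
theorem tensorForm_tmul (α β : Module.Dual 𝕜 (H 𝕜)) (x y : H 𝕜) :
    tensorForm α β (x ⊗ₜ y) = α x * β y := by
  simp [tensorForm]

theorem conv_apply (α β : Module.Dual 𝕜 (H 𝕜)) (x : H 𝕜) :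
    conv α β x = tensorForm α β (Δ 𝕜 x) := rfl

/-- The algebra endomorphism `(id ⊗ γ) ∘ ρ` of `H`. -/
def actEnd (γ : B 𝕜 →ₐ[𝕜] 𝕜) : H 𝕜 →ₐ[𝕜] H 𝕜 :=
  (Algebra.TensorProduct.rid 𝕜 𝕜 (H 𝕜)).toAlgHom.comp
    ((Algebra.TensorProduct.map (AlgHom.id 𝕜 (H 𝕜)) γ).comp (ρ 𝕜))

theorem act_apply (α : Module.Dual 𝕜 (H 𝕜)) (γ : B 𝕜 →ₐ[𝕜] 𝕜) (x : H 𝕜) :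
    act α γ x = α (actEnd γ x) := by
  change (LinearMap.mul' 𝕜 𝕜 ∘ₗ TensorProduct.map α γ.toLinearMap) (ρ 𝕜 x) =
    α (Algebra.TensorProduct.rid 𝕜 𝕜 (H 𝕜)
      (Algebra.TensorProduct.map (AlgHom.id 𝕜 (H 𝕜)) γ (ρ 𝕜 x)))
  generalize ρ 𝕜 x = t
  induction t with
  | zero => simp
  | tmul a b => simp [mul_comm]
  | add s t hs ht => simp only [map_add, hs, ht]

theorem actEnd_ι (γ : B 𝕜 →ₐ[𝕜] 𝕜) (P : NCP) :
    actEnd γ (FreeAlgebra.ι 𝕜 P) =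
      ∑ Q : P.1.coarsenings, γ (fibre 𝕜 P.1 Q.1) • genH 𝕜 (P.1.coarsen Q) := by
  simp [actEnd, ρ, map_sum]

/-- The cointeraction is a hypothesis `hγ` here, so that the formal part stays separate from the
combinatorics; `Δ_comp_actEnd` supplies it. -/
theorem conv_act (γ : B 𝕜 →ₐ[𝕜] 𝕜)
    (hγ : (Δ 𝕜).comp (actEnd γ) =
      (Algebra.TensorProduct.map (actEnd γ) (actEnd γ)).comp (Δ 𝕜))
    (α β : Module.Dual 𝕜 (H 𝕜)) : act (conv α β) γ = conv (act α γ) (act β γ) := by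
  ext x
  rw [act_apply, conv_apply, conv_apply, ← AlgHom.comp_apply, hγ, AlgHom.comp_apply]
  generalize Δ 𝕜 x = t
  induction t with
  | zero => simp
  | tmul a b => simp [act_apply]
  | add s t hs ht => simp only [map_add, hs, ht]

theorem counitH_genH (P : NCP₀) : counitH 𝕜 (genH 𝕜 P) = if 0 < P.deg then 0 else 1 := by
  by_cases h : 0 < P.deg <;> simp [genH, counitH, h]

/-- Coarsening does not change the underlying set, so no term becomes the empty partition. -/
theorem counitH_actEnd (γ : B 𝕜 →ₐ[𝕜] 𝕜) : (counitH 𝕜).comp (actEnd γ) = counitH 𝕜 := by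
  apply FreeAlgebra.hom_ext
  funext P
  have hP : counitH 𝕜 (FreeAlgebra.ι 𝕜 P) = 0 := by simp [counitH]
  simp only [Function.comp_apply, AlgHom.comp_apply, actEnd_ι, map_sum, map_smul, hP]
  refine Finset.sum_eq_zero fun Q _ => ?_
  rw [counitH_genH, if_pos (show 0 < (P.1.coarsen Q).deg from P.2), smul_zero]

theorem act_counitH (γ : B 𝕜 →ₐ[𝕜] 𝕜) :
    act (counitH 𝕜).toLinearMap γ = (counitH 𝕜).toLinearMap := by
  ext x
  rw [act_apply]
  exact DFunLike.congr_fun (counitH_actEnd γ) x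

theorem act_mem_characters {φ : Module.Dual 𝕜 (H 𝕜)} (hφ : φ ∈ characters 𝕜)
    (γ : B 𝕜 →ₐ[𝕜] 𝕜) : act φ γ ∈ characters 𝕜 :=
  ⟨by rw [act_apply, map_one, hφ.1], fun x y => by simp only [act_apply, map_mul, hφ.2]⟩

theorem act_mem_infChar {κ : Module.Dual 𝕜 (H 𝕜)} (hκ : κ ∈ infChar 𝕜)
    (γ : B 𝕜 →ₐ[𝕜] 𝕜) : act κ γ ∈ infChar 𝕜 := by
  have h (x : H 𝕜) : counitH 𝕜 (actEnd γ x) = counitH 𝕜 x :=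
    DFunLike.congr_fun (counitH_actEnd γ) x
  exact ⟨by rw [act_apply, map_one, hκ.1], fun x y hx hy => by
    rw [act_apply, map_mul]
    exact hκ.2 _ _ (by rw [h, hx]) (by rw [h, hy])⟩

/-- An ε-derivation rule, obtained from the vanishing on (H₊)² at x - ε(x) and y - ε(y). -/
theorem infChar_mul (κ : infChar 𝕜) (x y : H 𝕜) :
    κ.1 (x * y) = κ.1 x * counitH 𝕜 y + counitH 𝕜 x * κ.1 y := by
  have h := κ.2.2 (x - algebraMap 𝕜 _ (counitH 𝕜 x)) (y - algebraMap 𝕜 _ (counitH 𝕜 y))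
    (by simp) (by simp)
  have h1 := κ.2.1
  simp only [Algebra.algebraMap_eq_smul_one, sub_mul, mul_sub, smul_mul_assoc, mul_smul_comm,
    one_mul, mul_one, map_sub, map_smul, h1, smul_eq_mul] at h
  linear_combination h

theorem infChar_ext {κ μ : infChar 𝕜}
    (h : ∀ P : NCP, κ.1 (FreeAlgebra.ι 𝕜 P) = μ.1 (FreeAlgebra.ι 𝕜 P)) : κ = μ := by
  ext x
  induction x using FreeAlgebra.induction with
  | grade0 r =>
    have h1 := κ.2.1
    have h2 := μ.2.1
    simp [Algebra.algebraMap_eq_smul_one, h1, h2]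
  | grade1 P => exact h P
  | mul a b ha hb => rw [infChar_mul, infChar_mul, ha, hb]
  | add a b ha hb => rw [map_add, map_add, ha, hb]

theorem convPow_act (γ : B 𝕜 →ₐ[𝕜] 𝕜)
    (hγ : (Δ 𝕜).comp (actEnd γ) =
      (Algebra.TensorProduct.map (actEnd γ) (actEnd γ)).comp (Δ 𝕜))
    (α : Module.Dual 𝕜 (H 𝕜)) (n : ℕ) : act (convPow α n) γ = convPow (act α γ) n := by
  induction n with
  | zero => exact act_counitH γ
  | succ n ih => rw [convPow, convPow, conv_act γ hγ, ih]

theorem expStar_act (γ : B 𝕜 →ₐ[𝕜] 𝕜)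
    (hγ : (Δ 𝕜).comp (actEnd γ) =
      (Algebra.TensorProduct.map (actEnd γ) (actEnd γ)).comp (Δ 𝕜))
    (κ : infChar 𝕜) : act (expStar κ) γ = expStar ⟨act κ.1 γ, act_mem_infChar κ.2 γ⟩ := by
  ext x
  rw [act_apply]
  refine finsum_congr fun n => ?_
  rw [← convPow_act γ hγ, act_apply]

/-! ### The exponential of an infinitesimal character is a character. -/

/-- The divided convolution powers `κ^{⋆n} / n!`. -/
def divPow (κ : infChar 𝕜) (n : ℕ) : Module.Dual 𝕜 (H 𝕜) :=
  (n.factorial : 𝕜)⁻¹ • convPow κ.1 n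

theorem divPow_apply (κ : infChar 𝕜) (n : ℕ) (x : H 𝕜) :
    divPow κ n x = (n.factorial : 𝕜)⁻¹ * convPow κ.1 n x := rfl

theorem tensorForm_divPow_succ [CharZero 𝕜] (κ : infChar 𝕜) (n : ℕ) (x : H 𝕜) :
    tensorForm κ.1 (divPow κ n) (Δ 𝕜 x) = (n + 1) * divPow κ (n + 1) x := by
  have h : tensorForm κ.1 (divPow κ n) = (n.factorial : 𝕜)⁻¹ • tensorForm κ.1 (convPow κ.1 n) := by
    ext a b
    simp [divPow_apply]
    ring
  have hn : (n.factorial : 𝕜) ≠ 0 := by exact_mod_cast n.factorial_ne_zero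
  have hn' : (n + 1 : 𝕜) ≠ 0 := by exact_mod_cast n.succ_ne_zero
  rw [h, LinearMap.smul_apply, ← conv_apply, divPow_apply, convPow, Nat.factorial_succ]
  push_cast
  rw [smul_eq_mul]
  field_simp

/-- Induction on n through the recursion (n + 1) κ_{n+1} = κ ⋆ κ_n for κ_n = κ^{⋆n}/n!. Since κ is
an ε-derivation, it acts on one of the two factors at a time, while ε on the other factor disappears
by `hε`. -/
theorem divPow_mul [CharZero 𝕜]
    (hε : ∀ (α : Module.Dual 𝕜 (H 𝕜)) x, conv (counitH 𝕜).toLinearMap α x = α x)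
    (κ : infChar 𝕜) (n : ℕ) (x y : H 𝕜) :
    divPow κ n (x * y) = ∑ p ∈ Finset.HasAntidiagonal.antidiagonal n, divPow κ p.1 x * divPow κ p.2 y := by
  induction n generalizing x y with
  | zero => simp [divPow_apply, convPow]
  | succ n ih =>
    -- Stated for arbitrary tensors in place of Δ(x) and Δ(y), so that bilinearity reduces it to
    -- pure tensors.
    have key (s t : H 𝕜 ⊗[𝕜] H 𝕜) : tensorForm κ.1 (divPow κ n) (s * t) =
        ∑ p ∈ Finset.HasAntidiagonal.antidiagonal n,
          (tensorForm κ.1 (divPow κ p.1) s *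
              tensorForm (counitH 𝕜).toLinearMap (divPow κ p.2) t +
            tensorForm (counitH 𝕜).toLinearMap (divPow κ p.1) s *
              tensorForm κ.1 (divPow κ p.2) t) := by
      induction s with
      | zero => simp
      | add s s' hs hs' =>
        rw [add_mul, map_add, hs, hs', ← Finset.sum_add_distrib]
        refine Finset.sum_congr rfl fun p _ => ?_
        simp only [map_add]
        ring
      | tmul a b =>
        induction t with
        | zero => simp
        | add t t' ht ht' =>
          rw [mul_add, map_add, ht, ht', ← Finset.sum_add_distrib]
          refine Finset.sum_congr rfl fun p _ => ?_
          simp only [map_add]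
          ring
        | tmul c d =>
          rw [Algebra.TensorProduct.tmul_mul_tmul, tensorForm_tmul, infChar_mul, ih,
            Finset.mul_sum]
          refine Finset.sum_congr rfl fun p _ => ?_
          simp only [tensorForm_tmul, AlgHom.toLinearMap_apply]
          ring
    have h := key (Δ 𝕜 x) (Δ 𝕜 y)
    rw [← map_mul, tensorForm_divPow_succ] at h
    simp only [← conv_apply, hε] at h
    simp only [conv_apply, tensorForm_divPow_succ] at h
    have hn' : (n + 1 : 𝕜) ≠ 0 := by exact_mod_cast n.succ_ne_zero
    apply mul_left_cancel₀ hn'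
    rw [h, Finset.sum_add_distrib]
    -- Splitting the weight n + 1 as p.1 + p.2 gives two sums whose terms of weight 0 drop out;
    -- shifting the index then matches the recursion.
    have hsum : (n + 1 : 𝕜) * ∑ p ∈ Finset.HasAntidiagonal.antidiagonal (n + 1), divPow κ p.1 x * divPow κ p.2 y
        = ∑ p ∈ Finset.HasAntidiagonal.antidiagonal (n + 1), (p.1 : 𝕜) * divPow κ p.1 x * divPow κ p.2 y +
          ∑ p ∈ Finset.HasAntidiagonal.antidiagonal (n + 1), divPow κ p.1 x * ((p.2 : 𝕜) * divPow κ p.2 y) := by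
      rw [Finset.mul_sum, ← Finset.sum_add_distrib]
      refine Finset.sum_congr rfl fun p hp => ?_
      have : (n + 1 : 𝕜) = p.1 + p.2 := by exact_mod_cast (Finset.HasAntidiagonal.mem_antidiagonal.1 hp).symm
      rw [this]
      ring
    rw [hsum, Finset.Nat.sum_antidiagonal_succ, Finset.Nat.sum_antidiagonal_succ']
    simp

/-- The polynomial whose coefficients are the terms of the exponential series at `x`. -/
def expPoly (κ : infChar 𝕜) (x : H 𝕜) : Polynomial 𝕜 :=
  ∑ n ∈ (expSeries_finite κ x).toFinset, Polynomial.monomial n (divPow κ n x)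

theorem coeff_expPoly (κ : infChar 𝕜) (x : H 𝕜) (n : ℕ) :
    (expPoly κ x).coeff n = divPow κ n x := by
  simp only [expPoly, Polynomial.finsetSum_coeff, Polynomial.coeff_monomial, Finset.sum_ite_eq',
    Set.Finite.mem_toFinset, Function.mem_support, ← divPow_apply]
  by_cases h : divPow κ n x = 0 <;> simp [h]

theorem eval_expPoly (κ : infChar 𝕜) (x : H 𝕜) : (expPoly κ x).eval 1 = expStar κ x := by
  simp only [expPoly, Polynomial.eval_finsetSum, Polynomial.eval_monomial, one_pow, mul_one]
  exact (finsum_eq_sum _ (expSeries_finite κ x)).symm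

theorem expStar_mem_characters [CharZero 𝕜]
    (hε : ∀ (α : Module.Dual 𝕜 (H 𝕜)) x, conv (counitH 𝕜).toLinearMap α x = α x)
    (κ : infChar 𝕜) : expStar κ ∈ characters 𝕜 := by
  refine ⟨?_, fun x y => ?_⟩
  · change (∑ᶠ n : ℕ, (n.factorial : 𝕜)⁻¹ * convPow κ.1 n 1) = 1
    rw [finsum_eq_single _ 0]
    · simp [convPow]
    · intro n hn
      obtain ⟨m, rfl⟩ := Nat.exists_eq_succ_of_ne_zero hn
      have h1 := κ.2.1
      rw [convPow, conv_apply, map_one, Algebra.TensorProduct.one_def, tensorForm_tmul, h1]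
      simp
  -- Evaluation of polynomials at 1 is multiplicative, so a comparison of coefficients, which is the
  -- binomial rule, replaces a product of infinite sums.
  · rw [← eval_expPoly, ← eval_expPoly, ← eval_expPoly, ← Polynomial.eval_mul]
    congr 1
    ext n
    simp only [Polynomial.coeff_mul, coeff_expPoly, divPow_mul hε]

end Algebraic

/-! ### Restrictions of partitions and their compatibility with decompositions. -/

section Combinatorics

theorem NCP₀.eq_restrict {P Q : NCP₀} {X : Finset (Fin P.deg)} (f : Fin Q.deg → Fin P.deg)
    (hf : StrictMono f) (hX : ∀ a, a ∈ X ↔ a ∈ Set.range f)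
    (h : ∀ i j, Q.rel i j ↔ P.rel (f i) (f j)) : Q = P.restrict X := by
  obtain ⟨m, r, nc⟩ := Q
  have hX' : X = Finset.univ.image f := by
    ext a
    simp [hX]
  -- With Q destructured, its degree m is a free variable and can be replaced by `X.card`, so no
  -- transport between `Fin` types is needed.
  have hc : X.card = m := by
    rw [hX', Finset.card_image_of_injective _ hf.injective, Finset.card_fin]
  subst hc
  have hfe : f = X.orderEmbOfFin rfl :=
    Finset.orderEmbOfFin_unique rfl (fun i => (hX _).2 ⟨i, rfl⟩) hf
  have hr : r = P.rel.comap (X.orderEmbOfFin rfl) := Setoid.ext fun i j => by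
    rw [h, hfe]
    rfl
  simp only [NCP₀.restrict, hr]

theorem NCP₀.restrict_of_eq_univ (P : NCP₀) {X : Finset (Fin P.deg)} (hX : X = Finset.univ) :
    P.restrict X = P :=
  (NCP₀.eq_restrict id strictMono_id (by simp [hX]) fun _ _ => Iff.rfl).symm

theorem exists_orderEmbOfFin {n : ℕ} {X : Finset (Fin n)} {a : Fin n} (ha : a ∈ X) :
    ∃ x, X.orderEmbOfFin rfl x = a := by
  rw [← Finset.mem_coe, ← Finset.range_orderEmbOfFin X rfl] at ha
  exact ha

theorem NCP₀.restrict_restrict (P : NCP₀) (X : Finset (Fin P.deg)) (Y : Finset (Fin X.card)) :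
    (P.restrict X).restrict Y = P.restrict (Y.map (X.orderEmbOfFin rfl).toEmbedding) := by
  refine NCP₀.eq_restrict (P := P) (Q := (P.restrict X).restrict Y)
    (fun i : Fin Y.card => X.orderEmbOfFin rfl (Y.orderEmbOfFin rfl i))
    (fun a b hab => (X.orderEmbOfFin rfl).strictMono
      ((Y.orderEmbOfFin rfl).strictMono hab)) (fun a => ?_) (fun _ _ => Iff.rfl)
  rw [Finset.mem_map]
  constructor
  · rintro ⟨y, hy, rfl⟩
    obtain ⟨w, rfl⟩ := exists_orderEmbOfFin hy
    exact ⟨w, rfl⟩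
  · rintro ⟨i, rfl⟩
    exact ⟨_, Finset.orderEmbOfFin_mem Y rfl i, rfl⟩

/-! ### The fibre monomial as a product over the elements -/

section Fibre

variable (𝕜 : Type*) [Field 𝕜]

/-- The contribution of `x` to the monomial `P / Q`: the restriction of `P` to the block of `x`
if `x` is the least element of its block. -/
def blockFactor (P : NCP₀) (Q : Setoid (Fin P.deg)) (x : Fin P.deg) : B 𝕜 :=
  open Classical in
    if ∀ y, Q x y → x ≤ y then genB 𝕜 (P.restrict {y | Q y x}) else 1

/-- Each block is represented by its least element. A product over elements can be split along a
decomposition of [n] without comparing quotient types. -/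
theorem fibre_eq_prod (P : NCP₀) (Q : Setoid (Fin P.deg)) :
    fibre 𝕜 P Q = ∏ x, blockFactor 𝕜 P Q x := by
  classical
  simp only [blockFactor]
  rw [← Finset.prod_filter, fibre]
  symm
  refine Finset.prod_nbij (fun x => Quotient.mk Q x) (fun _ _ => Finset.mem_univ _) ?_ ?_ ?_
  · intro x hx y hy hxy
    have h : Q x y := Quotient.exact hxy
    simp only [Finset.coe_filter, Finset.mem_univ, true_and, Set.mem_ofPred_eq] at hx hy
    exact le_antisymm (hx y h) (hy x (Q.symm h))
  · intro τ _
    induction τ using Quotient.inductionOn with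
    | h a =>
      obtain ⟨x, hx, hmin⟩ := Finset.exists_min_image ({y | Q y a} : Finset (Fin P.deg)) id
        ⟨a, by simp⟩
      simp only [Finset.mem_filter, Finset.mem_univ, true_and, id] at hx hmin
      refine ⟨x, ?_, Quotient.sound hx⟩
      simp only [Finset.coe_filter, Finset.mem_univ, true_and, Set.mem_ofPred_eq]
      exact fun y hy => hmin y (Q.trans (Q.symm hy) hx)
  · intro x _
    congr 2
    ext y
    simp only [Finset.mem_filter, Finset.mem_univ, true_and]
    exact (Quotient.eq (r := Q)).symm

theorem blockFactor_restrict (P : NCP₀) (Q : Setoid (Fin P.deg)) (X : Finset (Fin P.deg))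
    (hX : ∀ a b, Q a b → a ∈ X → b ∈ X) (j : Fin X.card) :
    blockFactor 𝕜 (P.restrict X) (Q.comap (X.orderEmbOfFin rfl)) j =
      blockFactor 𝕜 P Q (X.orderEmbOfFin rfl j) := by
  classical
  have hmem (i : Fin X.card) : X.orderEmbOfFin rfl i ∈ X := X.orderEmbOfFin_mem rfl i
  have hmin : (∀ y : Fin X.card, (Q.comap (X.orderEmbOfFin rfl)) j y → j ≤ y) ↔
      ∀ y, Q (X.orderEmbOfFin rfl j) y → X.orderEmbOfFin rfl j ≤ y := by
    constructor
    · intro h y hy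
      obtain ⟨z, rfl⟩ := exists_orderEmbOfFin (hX _ _ hy (hmem j))
      exact (X.orderEmbOfFin rfl).le_iff_le.2 (h z hy)
    · exact fun h y hy => (X.orderEmbOfFin rfl).le_iff_le.1 (h _ hy)
  refine if_congr hmin (congrArg _ ?_) rfl
  refine (NCP₀.restrict_restrict P X
    {y | Q (X.orderEmbOfFin rfl y) (X.orderEmbOfFin rfl j)}).trans (congrArg _ (Finset.ext fun a => ?_))
  simp only [Finset.mem_map, Finset.mem_filter, Finset.mem_univ, true_and]
  constructor
  · rintro ⟨i, hi, rfl⟩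
    exact hi
  · intro ha
    obtain ⟨z, rfl⟩ := exists_orderEmbOfFin (hX _ _ (Q.symm ha) (hmem j))
    exact ⟨z, ha, rfl⟩

theorem fibre_eq_prod_pieces (P : NCP₀) (Q : Setoid (Fin P.deg)) {ι : Type*} [Fintype ι]
    (X : ι → Finset (Fin P.deg)) (hX : ∀ a, ∃! i, a ∈ X i)
    (hQ : ∀ i a b, Q a b → a ∈ X i → b ∈ X i) :
    fibre 𝕜 P Q =
      ∏ i, fibre 𝕜 (P.restrict (X i)) (Q.comap ((X i).orderEmbOfFin rfl)) := by
  classical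
  have huniv : (Finset.univ : Finset (Fin P.deg)) = Finset.univ.biUnion X := by
    ext a
    obtain ⟨i, hi, -⟩ := hX a
    simpa using ⟨i, hi⟩
  rw [fibre_eq_prod, huniv, Finset.prod_biUnion]
  · refine Finset.prod_congr rfl fun i _ => ?_
    rw [fibre_eq_prod]
    conv_lhs => rw [← Finset.map_orderEmbOfFin_univ (X i) rfl, Finset.prod_map]
    exact Finset.prod_congr rfl fun j _ => (blockFactor_restrict 𝕜 P Q (X i) (hQ i) j).symm
  · intro i _ j _ hij
    exact Finset.disjoint_left.2 fun a hi hj => hij ((hX a).unique hi hj)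

end Fibre

/-! ### Glueing partitions along a decomposition -/

/-- The partition with given restrictions to the pieces of a decomposition of `[n]`, each of
which is a union of blocks. -/
def glue {n : ℕ} {ι : Type*} (X : ι → Finset (Fin n)) (hX : ∀ a, ∃! i, a ∈ X i)
    (r : ∀ i, Setoid (Fin (X i).card)) : Setoid (Fin n) where
  r a b := ∃ i x y, (X i).orderEmbOfFin rfl x = a ∧ (X i).orderEmbOfFin rfl y = b ∧ r i x y
  iseqv :=
    { refl := fun a => by
        obtain ⟨i, hi, -⟩ := hX a
        obtain ⟨x, hx⟩ := exists_orderEmbOfFin hi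
        exact ⟨i, x, x, hx, hx, (r i).refl x⟩
      symm := by
        rintro _ _ ⟨i, x, y, hx, hy, h⟩
        exact ⟨i, y, x, hy, hx, (r i).symm h⟩
      trans := by
        rintro _ b _ ⟨i, x, y, hx, hy, h⟩ ⟨j, z, w, hz, hw, h'⟩
        obtain rfl : i = j := (hX b).unique (hy ▸ Finset.orderEmbOfFin_mem _ _ _)
          (hz ▸ Finset.orderEmbOfFin_mem _ _ _)
        obtain rfl : y = z := (Finset.orderEmbOfFin _ rfl).injective (hy.trans hz.symm)
        exact ⟨i, x, w, hx, hw, (r i).trans h h'⟩ }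

section Glue

variable {n : ℕ} {ι : Type*} {X : ι → Finset (Fin n)} (hX : ∀ a, ∃! i, a ∈ X i)
  (r : ∀ i, Setoid (Fin (X i).card))

theorem glue_orderEmbOfFin (i : ι) (x y : Fin (X i).card) :
    glue X hX r ((X i).orderEmbOfFin rfl x) ((X i).orderEmbOfFin rfl y) ↔ r i x y := by
  refine ⟨?_, fun h => ⟨i, x, y, rfl, rfl, h⟩⟩
  rintro ⟨j, z, w, hz, hw, h⟩
  obtain rfl : j = i := (hX _).unique (hz ▸ Finset.orderEmbOfFin_mem _ _ _)
    (Finset.orderEmbOfFin_mem _ _ _)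
  obtain rfl := (Finset.orderEmbOfFin _ rfl).injective hz
  obtain rfl := (Finset.orderEmbOfFin _ rfl).injective hw
  exact h

theorem comap_glue (i : ι) : (glue X hX r).comap ((X i).orderEmbOfFin rfl) = r i :=
  Setoid.ext fun x y => glue_orderEmbOfFin hX r i x y

theorem glue_mem {i : ι} {a b : Fin n} (h : glue X hX r a b) (ha : a ∈ X i) : b ∈ X i := by
  obtain ⟨j, x, y, rfl, rfl, h⟩ := h
  obtain rfl : j = i := (hX _).unique (Finset.orderEmbOfFin_mem _ _ _) ha
  exact Finset.orderEmbOfFin_mem _ _ _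

/-- By `hcross`, two crossing blocks would have to lie in the same piece, where `hr` applies. -/
theorem isNoncrossing_glue (hr : ∀ i, IsNoncrossing (r i))
    (hcross : ∀ i j (a c b d : Fin n), a < c → c < b → b < d → a ∈ X i → b ∈ X i →
      c ∈ X j → d ∈ X j → i = j) : IsNoncrossing (glue X hX r) := by
  intro a c b d hac hcb hbd hab hcd
  obtain ⟨i, x, y, rfl, rfl, h⟩ := hab
  obtain ⟨j, z, w, rfl, rfl, h'⟩ := hcd
  obtain rfl := hcross i j _ _ _ _ hac hcb hbd (Finset.orderEmbOfFin_mem _ _ _)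
    (Finset.orderEmbOfFin_mem _ _ _) (Finset.orderEmbOfFin_mem _ _ _)
    (Finset.orderEmbOfFin_mem _ _ _)
  rw [OrderEmbedding.lt_iff_lt] at hac hcb hbd
  exact ⟨i, x, z, rfl, rfl, hr i x z y w hac hcb hbd h h'⟩

theorem setoid_eq_of_comap_eq {Q Q' : Setoid (Fin n)} (hX : ∀ a, ∃ i, a ∈ X i)
    (hQ : ∀ i a b, Q a b → a ∈ X i → b ∈ X i) (hQ' : ∀ i a b, Q' a b → a ∈ X i → b ∈ X i)
    (h : ∀ i, Q.comap ((X i).orderEmbOfFin rfl) = Q'.comap ((X i).orderEmbOfFin rfl)) :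
    Q = Q' := by
  have h' (i : ι) (x y : Fin (X i).card) :
      Q ((X i).orderEmbOfFin rfl x) ((X i).orderEmbOfFin rfl y) ↔
        Q' ((X i).orderEmbOfFin rfl x) ((X i).orderEmbOfFin rfl y) :=
    Setoid.ext_iff.1 (h i) x y
  refine Setoid.ext fun a b => ?_
  obtain ⟨i, ha⟩ := hX a
  constructor
  · intro hab
    obtain ⟨x, rfl⟩ := exists_orderEmbOfFin ha
    obtain ⟨y, rfl⟩ := exists_orderEmbOfFin (hQ i _ _ hab ha)
    exact (h' i x y).1 hab
  · intro hab
    obtain ⟨x, rfl⟩ := exists_orderEmbOfFin ha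
    obtain ⟨y, rfl⟩ := exists_orderEmbOfFin (hQ' i _ _ hab ha)
    exact (h' i x y).2 hab

end Glue

/-! ### The decomposition given by a set and its gaps -/

/-- The pieces of `[n]` cut out by `L`: the set `L` itself and its gaps. -/
def piece {n : ℕ} (L : Finset (Fin n)) : Option (Fin (L.card + 1)) → Finset (Fin n)
  | none => L
  | some i => gap L i

theorem mem_gap {n : ℕ} {L : Finset (Fin n)} {i : ℕ} {y : Fin n} :
    y ∈ gap L i ↔ y ∉ L ∧ (L.filter (· < y)).card = i := by
  simp [gap]

theorem card_filter_lt_eq_iff {n : ℕ} {L : Finset (Fin n)} {a b : Fin n} (hab : a ≤ b)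
    (ha : a ∉ L) : (L.filter (· < a)).card = (L.filter (· < b)).card ↔
      ∀ x ∈ L, a < x → ¬ x < b := by
  have hsub : L.filter (· < a) ⊆ L.filter (· < b) :=
    Finset.monotone_filter_right L fun x _ hx => lt_of_lt_of_le hx hab
  constructor
  · intro h x hx hax hxb
    have hE := Finset.eq_of_subset_of_card_le hsub h.ge
    have : x ∈ L.filter (· < a) := by rw [hE]; exact Finset.mem_filter.2 ⟨hx, hxb⟩
    exact lt_asymm hax (Finset.mem_filter.1 this).2
  · intro h
    congr 1
    refine Finset.Subset.antisymm hsub fun x hx => ?_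
    rw [Finset.mem_filter] at hx ⊢
    refine ⟨hx.1, lt_of_le_of_ne (not_lt.1 fun hax => h x hx.1 hax hx.2) ?_⟩
    rintro rfl
    exact ha hx.1

theorem existsUnique_mem_piece {n : ℕ} (L : Finset (Fin n)) (a : Fin n) :
    ∃! o, a ∈ piece L o := by
  by_cases ha : a ∈ L
  · refine ⟨none, ha, ?_⟩
    rintro (_ | i) hi
    · rfl
    · exact absurd ha (mem_gap.1 hi).1
  · refine ⟨some ⟨(L.filter (· < a)).card, Nat.lt_succ_of_le (Finset.card_filter_le _ _)⟩,
      mem_gap.2 ⟨ha, rfl⟩, ?_⟩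
    rintro (_ | i) hi
    · exact absurd hi ha
    · exact congrArg some (Fin.ext (mem_gap.1 hi).2.symm)

/-- Two elements of one gap have no element of L between them. This excludes a crossing of L with a
gap, and forces an element outside L that lies between two elements of a gap into that same gap. -/
theorem piece_eq_of_crossing {n : ℕ} (L : Finset (Fin n)) (o o' : Option (Fin (L.card + 1)))
    (a c b d : Fin n) (hac : a < c) (hcb : c < b) (hbd : b < d) (ha : a ∈ piece L o)
    (hb : b ∈ piece L o) (hc : c ∈ piece L o') (hd : d ∈ piece L o') : o = o' := by
  rcases o with _ | i <;> rcases o' with _ | j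
  · rfl
  · obtain ⟨hc, hc'⟩ := mem_gap.1 hc
    obtain ⟨hd, hd'⟩ := mem_gap.1 hd
    exact absurd hbd ((card_filter_lt_eq_iff (hcb.trans hbd).le hc).1 (hc'.trans hd'.symm) b hb hcb)
  · obtain ⟨ha, ha'⟩ := mem_gap.1 ha
    obtain ⟨hb, hb'⟩ := mem_gap.1 hb
    exact absurd hcb ((card_filter_lt_eq_iff (hac.trans hcb).le ha).1 (ha'.trans hb'.symm) c hc hac)
  · obtain ⟨ha, ha'⟩ := mem_gap.1 ha
    obtain ⟨hb, hb'⟩ := mem_gap.1 hb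
    obtain ⟨hc, hc'⟩ := mem_gap.1 hc
    have h := (card_filter_lt_eq_iff hac.le ha).2 fun x hx hax hxc =>
      (card_filter_lt_eq_iff (hac.trans hcb).le ha).1 (ha'.trans hb'.symm) x hx hax
        (hxc.trans hcb)
    exact congrArg some (Fin.ext (ha'.symm.trans (h.trans hc')))

/-- A set is a lowerset if and only if it and its gaps are unions of blocks. -/
theorem NCP₀.isLowerset_iff (P : NCP₀) (L : Finset (Fin P.deg)) :
    P.IsLowerset L ↔ ∀ o a b, P.rel a b → a ∈ piece L o → b ∈ piece L o := by
  constructor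
  · rintro ⟨h1, h2⟩ (_ | i) a b hab ha
    · exact h1 a b hab ha
    · obtain ⟨ha, ha'⟩ := mem_gap.1 ha
      have hb : b ∉ L := fun hb => ha (h1 b a (P.rel.symm hab) hb)
      refine mem_gap.2 ⟨hb, ?_⟩
      rw [← ha']
      rcases le_total a b with h | h
      · exact ((card_filter_lt_eq_iff h ha).2 fun x hx hax hxb =>
          ha (h2 a x b hab hax.le hxb.le hx)).symm
      · exact (card_filter_lt_eq_iff h hb).2 fun x hx hax hxb =>
          hb (h2 b x a (P.rel.symm hab) hax.le hxb.le hx)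
  · intro h
    refine ⟨fun a b => h none a b, fun a b c hac hab hbc hb => ?_⟩
    obtain ⟨o, ho, -⟩ := existsUnique_mem_piece L a
    rcases o with _ | i
    · exact ho
    · obtain ⟨hc, hc'⟩ := mem_gap.1 (h _ a c hac ho)
      obtain ⟨ha, ha'⟩ := mem_gap.1 ho
      refine absurd (lt_of_le_of_ne hbc ?_) ((card_filter_lt_eq_iff (hab.trans hbc) ha).1
        (ha'.trans hc'.symm) b hb (lt_of_le_of_ne hab ?_))
      · rintro rfl
        exact hc hb
      · rintro rfl
        exact ha hb

/-- The restriction of a coarsening of `P` to a subset. -/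
def NCP₀.restrictCoarsening (P : NCP₀) (X : Finset (Fin P.deg)) (Q : P.coarsenings) :
    (P.restrict X).coarsenings :=
  ⟨Q.1.comap (X.orderEmbOfFin rfl), ((P.restrict X).mem_coarsenings _).2
    ⟨fun _ _ h => ((P.mem_coarsenings Q.1).1 Q.2).1 h, ((P.coarsen Q).restrict X).noncrossing⟩⟩

theorem NCP₀.isLowerset_of_coarsen {P : NCP₀} {Q : P.coarsenings} {L : Finset (Fin P.deg)}
    (h : (P.coarsen Q).IsLowerset L) : P.IsLowerset L := by
  have hQ := ((P.mem_coarsenings Q.1).1 Q.2).1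
  exact ⟨fun a b hab => h.1 a b (hQ hab), fun a b c hac => h.2 a b c (hQ hac)⟩

/-- A family of coarsenings of the restrictions of `P` to the pieces cut out by a lowerset comes
from a coarsening of `P` with the same lowerset. -/
theorem NCP₀.exists_coarsening {P : NCP₀} {L : Finset (Fin P.deg)} (hL : P.IsLowerset L)
    (r : ∀ o, (P.restrict (piece L o)).coarsenings) :
    ∃ Q : P.coarsenings, (P.coarsen Q).IsLowerset L ∧
      ∀ o, P.restrictCoarsening (piece L o) Q = r o := by
  have hX := existsUnique_mem_piece L
  have hr (o) := ((P.restrict (piece L o)).mem_coarsenings _).1 (r o).2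
  let Q := glue (piece L) hX fun o => (r o).1
  have hQ : Q ∈ P.coarsenings := by
    refine (P.mem_coarsenings Q).2 ⟨fun a b hab => ?_,
      isNoncrossing_glue hX _ (fun o => (hr o).2) (piece_eq_of_crossing L)⟩
    obtain ⟨o, ha, -⟩ := hX a
    obtain ⟨x, rfl⟩ := exists_orderEmbOfFin ha
    obtain ⟨y, rfl⟩ := exists_orderEmbOfFin ((P.isLowerset_iff L).1 hL o _ _ hab ha)
    exact ⟨o, x, y, rfl, rfl, (hr o).1 hab⟩
  exact ⟨⟨Q, hQ⟩, (NCP₀.isLowerset_iff (P.coarsen ⟨Q, hQ⟩) L).2 fun o a b hab ha => glue_mem hX _ hab ha,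
    fun o => Subtype.ext (comap_glue hX _ o)⟩

end Combinatorics

/-! ### Cointeraction of Δ and ρ. -/

section Cointeraction

variable {𝕜 : Type*} [Field 𝕜]

theorem genH_coe (P : NCP) : genH 𝕜 P.1 = FreeAlgebra.ι 𝕜 P := by
  rw [genH, dif_pos P.2]

theorem genH_of_deg_eq_zero {P : NCP₀} (h : P.deg = 0) : genH 𝕜 P = 1 := by
  rw [genH, dif_neg (by omega)]

theorem actEnd_genH (γ : B 𝕜 →ₐ[𝕜] 𝕜) (P : NCP₀) :
    actEnd γ (genH 𝕜 P) =
      ∑ Q : P.coarsenings, γ (fibre 𝕜 P Q.1) • genH 𝕜 (P.coarsen Q) := by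
  by_cases h : 0 < P.deg
  · rw [genH_coe ⟨P, h⟩, actEnd_ι]
  · replace h := Nat.eq_zero_of_not_pos h
    have : IsEmpty (Fin P.deg) := h ▸ Fin.isEmpty'
    have hs : Subsingleton P.coarsenings :=
      ⟨fun Q Q' => Subtype.ext (Setoid.ext fun a => isEmptyElim a)⟩
    -- In degree 0 there is one coarsening and its fibre is an empty product, so the formula agrees
    -- with the empty partition being 1.
    rw [genH_of_deg_eq_zero h, map_one, Fintype.sum_subsingleton _
      ⟨P.rel, (P.mem_coarsenings _).2 ⟨le_rfl, P.noncrossing⟩⟩, fibre_eq_prod,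
      genH_of_deg_eq_zero (P := P.coarsen _) h]
    simp

theorem gapMonomial_eq (P : NCP₀) (L : Finset (Fin P.deg)) :
    gapMonomial 𝕜 P L =
      (List.ofFn fun i => genH 𝕜 (P.restrict (piece L (some i)))).prod := by
  rw [gapMonomial, List.ofFn_eq_map, ← List.map_coe_finRange_eq_range, List.map_map]
  rfl

/-- The ordered product of sums is expanded by multilinearity, which keeps the noncommutative order
of the gaps. -/
theorem actEnd_gapMonomial (γ : B 𝕜 →ₐ[𝕜] 𝕜) (P : NCP₀) (L : Finset (Fin P.deg)) :
    actEnd γ (gapMonomial 𝕜 P L) =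
      ∑ r : ∀ i, (P.restrict (piece L (some i))).coarsenings,
        (∏ i, γ (fibre 𝕜 (P.restrict (piece L (some i))) (r i).1)) •
          (List.ofFn fun i => genH 𝕜 ((P.restrict (piece L (some i))).coarsen (r i))).prod := by
  classical
  rw [gapMonomial_eq, map_list_prod, List.map_ofFn]
  simp only [Function.comp_def, actEnd_genH]
  rw [← MultilinearMap.mkPiAlgebraFin_apply (R := 𝕜), MultilinearMap.map_sum]
  refine Finset.sum_congr rfl fun r _ => ?_
  rw [MultilinearMap.map_smul_univ, MultilinearMap.mkPiAlgebraFin_apply]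

/-- The part of the cointeraction identity that concerns a single lowerset. -/
theorem sum_coarsenings_of_isLowerset (γ : B 𝕜 →ₐ[𝕜] 𝕜) {P : NCP₀} {L : Finset (Fin P.deg)}
    (hL : P.IsLowerset L) [DecidablePred fun Q : P.coarsenings => (P.coarsen Q).IsLowerset L] :
    ∑ Q : P.coarsenings with (P.coarsen Q).IsLowerset L, γ (fibre 𝕜 P Q.1) •
        (genH 𝕜 ((P.coarsen Q).restrict L) ⊗ₜ[𝕜] gapMonomial 𝕜 (P.coarsen Q) L) =
      actEnd γ (genH 𝕜 (P.restrict L)) ⊗ₜ[𝕜] actEnd γ (gapMonomial 𝕜 P L) := by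
  classical
  rw [actEnd_genH, actEnd_gapMonomial, TensorProduct.sum_tmul]
  simp only [TensorProduct.tmul_sum]
  rw [← Fintype.sum_prod_type']
  refine Finset.sum_nbij
    (fun Q => (P.restrictCoarsening (piece L none) Q,
      fun i => P.restrictCoarsening (piece L (some i)) Q))
    (fun _ _ => Finset.mem_univ _) ?_ ?_ ?_
  · intro Q hQ Q' hQ' h
    simp only [Finset.coe_filter, Finset.mem_univ, true_and, Set.mem_ofPred_eq] at hQ hQ'
    refine Subtype.ext (setoid_eq_of_comap_eq (fun a => (existsUnique_mem_piece L a).exists)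
      ((NCP₀.isLowerset_iff (P.coarsen Q) L).1 hQ)
      ((NCP₀.isLowerset_iff (P.coarsen Q') L).1 hQ') ?_)
    rintro (_ | i)
    · exact congrArg Subtype.val (congrArg Prod.fst h)
    · exact congrArg Subtype.val (congrFun (congrArg Prod.snd h) i)
  -- Surjectivity is the glueing of independent coarsenings on L and on its gaps.
  · rintro ⟨q, r⟩ _
    obtain ⟨Q, hQ, h⟩ := NCP₀.exists_coarsening hL (fun o => match o with
      | none => q
      | some i => r i)
    exact ⟨Q, by simpa using hQ, Prod.ext (h none) (funext fun i => h (some i))⟩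
  · intro Q hQ
    have hQ' : (P.coarsen Q).IsLowerset L := by simpa using hQ
    have hfib := congrArg γ (fibre_eq_prod_pieces 𝕜 P Q.1 (piece L) (existsUnique_mem_piece L)
      ((NCP₀.isLowerset_iff (P.coarsen Q) L).1 hQ'))
    rw [Fintype.prod_option, map_mul, map_prod] at hfib
    refine Eq.trans ?_ (TensorProduct.smul_tmul_smul _ _ _ _).symm
    exact congrArg₂ (· • ·) hfib
      (congrArg (genH 𝕜 ((P.coarsen Q).restrict L) ⊗ₜ[𝕜] ·) (gapMonomial_eq (P.coarsen Q) L))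

/-- The endomorphisms `(id ⊗ γ) ∘ ρ` are compatible with the coproduct. -/
theorem Δ_comp_actEnd (γ : B 𝕜 →ₐ[𝕜] 𝕜) :
    (Δ 𝕜).comp (actEnd γ) =
      (Algebra.TensorProduct.map (actEnd γ) (actEnd γ)).comp (Δ 𝕜) := by
  classical
  apply FreeAlgebra.hom_ext
  funext P
  have hΔ (P : NCP₀) (hP : 0 < P.deg) : Δ 𝕜 (genH 𝕜 P) = cutSum 𝕜 P := by
    rw [genH_coe ⟨P, hP⟩]
    simp [Δ]
  simp only [Function.comp_apply, AlgHom.comp_apply]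
  rw [← genH_coe, actEnd_genH, hΔ P.1 P.2, cutSum, map_sum, map_sum]
  simp only [map_smul, Algebra.TensorProduct.map_tmul]
  calc ∑ Q : P.1.coarsenings, γ (fibre 𝕜 P.1 Q.1) • Δ 𝕜 (genH 𝕜 (P.1.coarsen Q))
      = ∑ Q : P.1.coarsenings, ∑ L : Finset (Fin P.1.deg) with (P.1.coarsen Q).IsLowerset L,
          γ (fibre 𝕜 P.1 Q.1) • (genH 𝕜 ((P.1.coarsen Q).restrict L) ⊗ₜ[𝕜]
            gapMonomial 𝕜 (P.1.coarsen Q) L) := by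
        refine Finset.sum_congr rfl fun Q _ => ?_
        rw [hΔ (P.1.coarsen Q) P.2, cutSum, Finset.smul_sum]
        exact Finset.sum_congr (by congr) fun _ _ => rfl
    _ = ∑ L : Finset (Fin P.1.deg) with P.1.IsLowerset L,
          ∑ Q : P.1.coarsenings with (P.1.coarsen Q).IsLowerset L,
            γ (fibre 𝕜 P.1 Q.1) • (genH 𝕜 ((P.1.coarsen Q).restrict L) ⊗ₜ[𝕜]
              gapMonomial 𝕜 (P.1.coarsen Q) L) := by
        -- Interchange of the sums: the outer condition that L be a lowerset of P is implied by its
        -- being one of Q.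
        have comm (p : P.1.coarsenings → Finset (Fin P.1.deg) → Prop)
            (q : Finset (Fin P.1.deg) → Prop) (hpq : ∀ Q L, p Q L → q L)
            (F : P.1.coarsenings → Finset (Fin P.1.deg) → H 𝕜 ⊗[𝕜] H 𝕜) :
            ∑ Q, ∑ L with p Q L, F Q L = ∑ L with q L, ∑ Q with p Q L, F Q L :=
          Finset.sum_comm' fun Q L => by
            simpa using fun h => hpq Q L h
        exact comm (fun Q L => (P.1.coarsen Q).IsLowerset L) _
          (fun _ _ => NCP₀.isLowerset_of_coarsen) _
    _ = _ := by
        refine Finset.sum_congr (by congr) fun L hL => ?_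
        exact sum_coarsenings_of_isLowerset γ (Finset.mem_filter.1 hL).2

/-- The counit is a left unit for the convolution product. -/
theorem counitH_conv (α : Module.Dual 𝕜 (H 𝕜)) (x : H 𝕜) :
    conv (counitH 𝕜).toLinearMap α x = α x := by
  have key : ((Algebra.TensorProduct.lid 𝕜 (H 𝕜)).toAlgHom.comp
      (Algebra.TensorProduct.map (counitH 𝕜) (AlgHom.id 𝕜 (H 𝕜)))).comp (Δ 𝕜) =
        AlgHom.id 𝕜 (H 𝕜) := by
    classical
    apply FreeAlgebra.hom_ext
    funext P
    have hΔ : Δ 𝕜 (FreeAlgebra.ι 𝕜 P) = cutSum 𝕜 P.1 := by simp [Δ]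
    have hgap : gapMonomial 𝕜 P.1 ∅ = FreeAlgebra.ι 𝕜 P := by
      have h : gap (∅ : Finset (Fin P.1.deg)) 0 = Finset.univ := by
        ext y
        simp [gap]
      rw [← genH_coe]
      simp [gapMonomial, NCP₀.restrict_of_eq_univ P.1 h]
    simp only [Function.comp_apply, AlgHom.comp_apply, AlgHom.id_apply]
    -- The counit kills P|L unless L is empty; then the only gap, of index 0, is the whole
    -- underlying set.
    rw [hΔ, cutSum, map_sum, map_sum, Finset.sum_eq_single ∅]
    · simp [hgap, counitH_genH, NCP₀.restrict]
    · intro L _ hL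
      have hL' : 0 < (P.1.restrict L).deg := Finset.card_pos.2 (Finset.nonempty_iff_ne_empty.2 hL)
      simp [counitH_genH, hL']
    · intro h
      exact absurd (Finset.mem_filter.2 ⟨Finset.mem_univ _, by simp [NCP₀.IsLowerset]⟩) h
  have h : α (Algebra.TensorProduct.lid 𝕜 (H 𝕜)
      (Algebra.TensorProduct.map (counitH 𝕜) (AlgHom.id 𝕜 (H 𝕜)) (Δ 𝕜 x))) = α x :=
    congrArg α (DFunLike.congr_fun key x)
  rw [← h, conv_apply]
  generalize Δ 𝕜 x = t
  induction t with
  | zero => simp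
  | tmul a b => simp
  | add s t hs ht => simp only [map_add, hs, ht]

theorem numBlocks_coarsen_eq_one_iff {P : NCP₀} (hP : 0 < P.deg) (Q : P.coarsenings) :
    (P.coarsen Q).numBlocks = 1 ↔ Q.1 = ⊤ := by
  have : Nonempty (Quotient Q.1) := ⟨Quotient.mk _ ⟨0, hP⟩⟩
  change Nat.card (Quotient Q.1) = 1 ↔ _
  rw [Nat.card_eq_one_iff_unique, and_iff_left this]
  exact Quotient.subsingleton_iff

theorem fibre_top {P : NCP₀} (hP : 0 < P.deg) : fibre 𝕜 P ⊤ = genB 𝕜 P := by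
  have hs : Subsingleton (Quotient (⊤ : Setoid (Fin P.deg))) := Quotient.subsingleton_iff.2 rfl
  classical
  rw [fibre, Fintype.prod_subsingleton _ (Quotient.mk _ ⟨0, hP⟩),
    NCP₀.restrict_of_eq_univ P (Finset.filter_true_of_mem fun _ _ => Subsingleton.elim _ _)]

/-- The infinitesimal character `e` generates: `e ↶ K = κ`. -/
theorem act_e (κ : infChar 𝕜) : act (e 𝕜).1 (bar (Theta κ)) = κ.1 := by
  refine congrArg Subtype.val (infChar_ext (κ := ⟨_, act_mem_infChar (e 𝕜).2 _⟩) (μ := κ) ?_)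
  intro P
  have he (R : NCP₀) (hR : 0 < R.deg) :
      (e 𝕜).1 (genH 𝕜 R) = if R.numBlocks = 1 then 1 else 0 := by
    rw [genH_coe ⟨R, hR⟩]
    exact infCharOf_ι _ _
  have htop : (⊤ : Setoid (Fin P.1.deg)) ∈ P.1.coarsenings :=
    (P.1.mem_coarsenings _).2 ⟨le_top, fun _ _ _ _ _ _ _ _ _ => trivial⟩
  change act (e 𝕜).1 (bar (Theta κ)) (FreeAlgebra.ι 𝕜 P) = _
  -- As e detects one-block partitions, only Q = ⊤ contributes; its fibre is P itself, on which K
  -- takes the value κ(P).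
  rw [act_apply, actEnd_ι, map_sum, Fintype.sum_eq_single ⟨⊤, htop⟩]
  · rw [map_smul, he (P.1.coarsen _) P.2,
      if_pos ((numBlocks_coarsen_eq_one_iff P.2 ⟨⊤, htop⟩).2 rfl), fibre_top P.2, genB,
      dif_pos P.2]
    simp [bar, Theta]
  · intro Q hQ
    rw [map_smul, he (P.1.coarsen _) P.2, if_neg, smul_zero]
    rw [numBlocks_coarsen_eq_one_iff P.2]
    exact fun h => hQ (Subtype.ext h)

end Cointeraction
end NCPart

end

open NCPart in
theorem mainTheorem11 (𝕜 : Type*) [Field 𝕜] [CharZero 𝕜] :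
    (∀ κ : infChar 𝕜,
      expStar κ ∈ characters 𝕜 ∧
      expStar κ = act (psiStar 𝕜) (bar (Theta κ)) ∧
      ∀ φ ∈ characters 𝕜, φ = expStar κ ↔ φ = act (psiStar 𝕜) (bar (Theta κ))) ∧
    (∀ γ : B 𝕜 →ₐ[𝕜] 𝕜,
      (∀ φ ∈ characters 𝕜, act φ γ ∈ characters 𝕜) ∧
      act (counitH 𝕜).toLinearMap γ = (counitH 𝕜).toLinearMap ∧
      (∀ φ ∈ characters 𝕜, ∀ ψ ∈ characters 𝕜,
        act (conv φ ψ) γ = conv (act φ γ) (act ψ γ)) ∧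
      (∀ κ ∈ infChar 𝕜, act κ γ ∈ infChar 𝕜) ∧
      (∀ κ ∈ infChar 𝕜, ∀ μ ∈ infChar 𝕜,
        act (bracket κ μ) γ = bracket (act κ γ) (act μ γ))) := by
  refine ⟨fun κ => ?_, fun γ => ⟨fun φ hφ => act_mem_characters hφ γ, act_counitH γ,
    fun φ _ ψ _ => conv_act γ (Δ_comp_actEnd γ) φ ψ, fun κ hκ => act_mem_infChar hκ γ,
    fun κ _ μ _ => ?_⟩⟩
  · have h : expStar κ = act (psiStar 𝕜) (bar (Theta κ)) := by
      -- The action moves inside the exponential, leaving e ↶ K = κ.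
      rw [psiStar, expStar_act _ (Δ_comp_actEnd _)]
      exact congrArg expStar (Subtype.ext (act_e κ).symm)
    exact ⟨expStar_mem_characters counitH_conv κ, h, fun φ _ => by rw [h]⟩
  · have hsub (α β : Module.Dual 𝕜 (H 𝕜)) : act (α - β) γ = act α γ - act β γ := by
      ext x
      simp [act_apply]
    rw [bracket, bracket, hsub, conv_act γ (Δ_comp_actEnd γ), conv_act γ (Δ_comp_actEnd γ)]
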